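/- A city consists of an axis-aligned rectangle $P=[a,b]\times[c,d]$ with $a<b$, $c<d$ in the ground plane $z=0$, and $k\ge 0$ buildings $B_i=R_i\times[0,h_i]$ with $h_i>0$, whose bases $R_i\subseteq P$ are pairwise disjoint, closed, non-degenerate axis-aligned rectangles. The heights are arbitrary and may differ. The ground is $\bigl(P\setminus\bigcup_i \operatorname{int}R_i\bigr)\times\{0\}$, the walls are the sets $\partial R_i\times[0,h_i]$, and the roofs are the sets $R_i\times\{h_i\}$. An axis-aligned camera with $180^\circ$ range of vision has a position $g$ and faces East, West, North or South. It sees a point $q$ if $q$ lies in the closed half-space in front of it, which is bounded by the vertical plane through $g$ perpendicular to the facing direction, and the segment $gq$ meets none of the sets $\operatorname{int}R_i\times[0,h_i)$ (a line of sight may graze walls and roofs). A camera on a building is located at one of the four top corners of that building. A camera at a corner of $P$ is located at ground level. Several cameras may share a position. A finite set of cameras guards the city if every point of the ground, of the walls and of the roofs is seen by at least one of them. Theorem. For every city with $k$ buildings: (i) if $k\ge 1$, the city can be guarded by at most $2k+\lfloor k/4\rfloor+4$ cameras, all placed on buildings; (ii) the city can be guarded by at most $2k+1$ cameras, of which at most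 one is placed at a corner of $P$ and all others are placed on buildings. -/

import Mathlib

namespace CityGuarding

/-- Points of space; the third coordinate is the height above the ground plane. -/
abbrev Point : Type := ℝ × ℝ × ℝ

/-- A non-degenerate axis-aligned rectangle `[x₁, x₂] × [y₁, y₂]` in the plane. -/
structure Rect where
  x₁ : ℝ
  x₂ : ℝ
  y₁ : ℝ
  y₂ : ℝ
  hx : x₁ < x₂
  hy : y₁ < y₂

/-- The closed rectangle. -/
def Rect.closed (R : Rect) : Set (ℝ × ℝ) := Set.Icc R.x₁ R.x₂ ×ˢ Set.Icc R.y₁ R.y₂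

/-- The open rectangle. -/
def Rect.inner (R : Rect) : Set (ℝ × ℝ) := Set.Ioo R.x₁ R.x₂ ×ˢ Set.Ioo R.y₁ R.y₂

/-- The four corners of an axis-aligned rectangle. -/
inductive Corner where
  | southWest
  | southEast
  | northWest
  | northEast

/-- The four axis-parallel viewing directions. -/
inductive Direction where
  | east
  | west
  | north
  | south

/-- The position of a corner of a rectangle. -/
def Rect.corner (R : Rect) : Corner → ℝ × ℝ
  | .southWest => (R.x₁, R.y₁)
  | .southEast => (R.x₂, R.y₁)
  | .northWest => (R.x₁, R.y₂)
  | .northEast => (R.x₂, R.y₂)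

/-- The region in front of a camera at `g`: the closed half-space on the viewing side of the
vertical plane through `g` that is perpendicular to the viewing direction. -/
def halfSpace (g : Point) : Direction → Set Point
  | .east => {q | g.1 ≤ q.1}
  | .west => {q | q.1 ≤ g.1}
  | .north => {q | g.2.1 ≤ q.2.1}
  | .south => {q | q.2.1 ≤ g.2.1}

/-- A vertical building standing on the ground: the prism over an axis-aligned rectangular base,
of positive height. -/
structure Building where
  base : Rect
  height : ℝ
  height_pos : 0 < height

/-- The part of the building that blocks lines of sight. Over the open base, everything from the
ground up to, but not including, the roof is opaque; walls and roof may be grazed. -/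
def Building.opaquePart (B : Building) : Set Point :=
  {q | (q.1, q.2.1) ∈ B.base.inner ∧ 0 ≤ q.2.2 ∧ q.2.2 < B.height}

/-- The roof of the building, a closed rectangle. -/
def Building.roof (B : Building) : Set Point :=
  {q | (q.1, q.2.1) ∈ B.base.closed ∧ q.2.2 = B.height}

/-- The union of the four closed walls of the building. -/
def Building.walls (B : Building) : Set Point :=
  {q | (q.1, q.2.1) ∈ B.base.closed \ B.base.inner ∧ 0 ≤ q.2.2 ∧ q.2.2 ≤ B.height}

/-- A city with `k` pairwise disjoint axis-aligned buildings within an axis-aligned rectangle. -/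
structure City (k : ℕ) where
  bounds : Rect
  building : Fin k → Building
  building_subset : ∀ i, (building i).base.closed ⊆ bounds.closed
  building_disjoint : ∀ i j, i ≠ j →
    Disjoint (building i).base.closed (building j).base.closed

/-- The places where a camera may be mounted: a top corner of a building, or a corner of the
bounding rectangle. -/
inductive Site (k : ℕ) where
  | onBuilding (i : Fin k) (c : Corner)
  | onBounds (c : Corner)

/-- An axis-aligned camera with a 180 degree range of vision: a site and a viewing direction. -/
structure Camera (k : ℕ) where
  site : Site k
  facing : Direction

/-- The camera is mounted on a building. -/
def Camera.IsOnBuilding {k : ℕ} (a : Camera k) : Prop :=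
  ∃ i c, a.site = Site.onBuilding i c

/-- The camera is mounted at a corner of the bounding rectangle. -/
def Camera.IsOnBounds {k : ℕ} (a : Camera k) : Prop :=
  ∃ c, a.site = Site.onBounds c

namespace City

variable {k : ℕ}

/-- The location of a site: roof height on a building, ground level on the bounding rectangle. -/
def position (K : City k) : Site k → Point
  | .onBuilding i c =>
      (((K.building i).base.corner c).1, ((K.building i).base.corner c).2, (K.building i).height)
  | .onBounds c => ((K.bounds.corner c).1, (K.bounds.corner c).2, 0)

/-- A camera sees the points in front of it to which the line of sight is not blocked by a
building. -/
def Sees (K : City k) (a : Camera k) (q : Point) : Prop :=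
  q ∈ halfSpace (K.position a.site) a.facing ∧
    ∀ i, Disjoint (segment ℝ (K.position a.site) q) (K.building i).opaquePart

/-- The ground: the bounding rectangle outside the open bases of the buildings. -/
def ground (K : City k) : Set Point :=
  {q | (q.1, q.2.1) ∈ K.bounds.closed ∧ (∀ i, (q.1, q.2.1) ∉ (K.building i).base.inner) ∧
    q.2.2 = 0}

/-- Everything that has to be guarded: the ground, all walls and all roofs. -/
def surface (K : City k) : Set Point :=
  K.ground ∪ (⋃ i, (K.building i).walls) ∪ ⋃ i, (K.building i).roof

/-- A set of cameras guards the city if every point of ground, walls and roofs is seen by at least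
one of them. -/
def IsGuardedBy (K : City k) (S : Finset (Camera k)) : Prop :=
  ∀ q ∈ K.surface, ∃ a ∈ S, K.Sees a q

end City

end CityGuarding

namespace CityGuarding

/-! Heights play no role away from the roofs: opaque parts stand over open bases, so a line of sight
whose projection avoids all open bases is free. Roofs only need one camera per building looking
across its own base. The rest is planar.

The engine is `exists_visible_corner`: a free point with rectangles to its south-west, inside a
suitable quadrant, sees the north-west or south-east corner of one of them. Hence two cameras per
building, all facing East, serve every point with a building to its south-west, and a camera at the
south-west corner of P serves the others. This is (ii).

For (i), let SW, SE, NW, NE be the sets of rectangles extremal towards each corner. A member of SE ∩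
NW or SW ∩ NE splits the family so that two extra cameras suffice (`guardable_of_extreme`).
Otherwise |SW \ SE| + 3 extra cameras suffice (`guardable_of_southWestMinimal`), and likewise for
the rotated pairs. The four differences are then disjoint, so the smallest has at most k/4 elements.
-/

/-! ### Visibility among rectangles in the plane -/

/-- The line of sight from `g` to `q` meets none of the open rectangles. -/
def Clear {ι : Type*} (R : ι → Rect) (g q : ℝ × ℝ) : Prop :=
  ∀ t : ℝ, 0 ≤ t → t ≤ 1 → ∀ j,
    (g.1 + t * (q.1 - g.1), g.2 + t * (q.2 - g.2)) ∉ (R j).inner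

/-- The closed half-plane in front of a camera. -/
def halfPlane (g : ℝ × ℝ) : Direction → Set (ℝ × ℝ)
  | .east => {q | g.1 ≤ q.1}
  | .west => {q | q.1 ≤ g.1}
  | .north => {q | g.2 ≤ q.2}
  | .south => {q | q.2 ≤ g.2}

/-- Distinct rectangles are separated by an axis-parallel line. -/
def Separated {ι : Type*} (R : ι → Rect) : Prop :=
  ∀ i j, i ≠ j →
    (R i).x₂ < (R j).x₁ ∨ (R j).x₂ < (R i).x₁ ∨ (R i).y₂ < (R j).y₁ ∨ (R j).y₂ < (R i).y₁

theorem Rect.not_mem_inner_iff (R : Rect) (q : ℝ × ℝ) :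
    q ∉ R.inner ↔ (R.x₁ < q.1 → R.y₁ < q.2 → q.1 < R.x₂ → R.y₂ ≤ q.2) := by
  simp only [Rect.inner, Set.mem_prod, Set.mem_Ioo, not_and, not_lt, and_imp]
  exact ⟨fun h a b c => h a c b, fun h a c b => h a b c⟩

/-- A point that blocks the line of sight, in coordinates. -/
theorem clear_of_forall {ι : Type*} {R : ι → Rect} {g q : ℝ × ℝ}
    (h : ∀ t : ℝ, 0 ≤ t → t ≤ 1 → ∀ j (px py : ℝ), px = g.1 + t * (q.1 - g.1) →
      py = g.2 + t * (q.2 - g.2) → (R j).x₁ < px → px < (R j).x₂ → (R j).y₁ < py →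
      py < (R j).y₂ → False) : Clear R g q := by
  intro t h0 h1 j hp
  simp only [Rect.inner, Set.mem_prod, Set.mem_Ioo] at hp
  exact h t h0 h1 j _ _ rfl rfl hp.1.1 hp.1.2 hp.2.1 hp.2.2

theorem lerp_le {g q t b : ℝ} (h0 : 0 ≤ t) (h1 : t ≤ 1) (hg : g ≤ b) (hq : q ≤ b) :
    g + t * (q - g) ≤ b := by
  nlinarith

theorem le_lerp {g q t b : ℝ} (h0 : 0 ≤ t) (h1 : t ≤ 1) (hg : b ≤ g) (hq : b ≤ q) :
    b ≤ g + t * (q - g) := by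
  nlinarith

/-- If some rectangle lies south-west of `q`, within the quadrant with apex `(u, v)`, then `q` sees
the north-west or the south-east corner of such a rectangle, south-west of `q`. -/
theorem exists_visible_corner {ι : Type*} [Finite ι] {R : ι → Rect} (hR : Separated R)
    {q : ℝ × ℝ} (hq : ∀ i, q ∉ (R i).inner) (u v : ℝ)
    (huv : ∀ i, (R i).x₁ < q.1 → (R i).y₁ < q.2 → u < (R i).x₂ → v < (R i).y₂ →
      u ≤ (R i).x₁ ∧ v ≤ (R i).y₁)
    (hex : ∃ i, (R i).x₁ < q.1 ∧ (R i).y₁ < q.2 ∧ u < (R i).x₂ ∧ v < (R i).y₂) :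
    ∃ i, (u < (R i).x₂ ∧ v < (R i).y₂) ∧ (R i).x₁ < q.1 ∧ (R i).y₁ < q.2 ∧
      (((R i).y₂ ≤ q.2 ∧ Clear R ((R i).corner .northWest) q) ∨
        ((R i).x₂ ≤ q.1 ∧ Clear R ((R i).corner .southEast) q)) := by
  classical
  obtain ⟨qx, qy⟩ := q
  simp only at huv hex ⊢
  simp only [Rect.not_mem_inner_iff] at hq
  set Rel : ι → Prop :=
    fun i => (R i).x₁ < qx ∧ (R i).y₁ < qy ∧ u < (R i).x₂ ∧ v < (R i).y₂ with hRel
  -- Slope of the line from the north-west corner to `q`. A blocker of this line has its own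
  -- north-west corner strictly above the line, hence a smaller slope: a minimizer is unblocked.
  let slope : ι → ℝ := fun i => (qy - (R i).y₂) / (qx - (R i).x₁)
  have slope_lt : ∀ i j, (R i).x₁ < qx → (R i).y₂ ≤ qy → ∀ t < 1,
      (R j).x₁ < (R i).x₁ + t * (qx - (R i).x₁) → (R i).y₂ + t * (qy - (R i).y₂) < (R j).y₂ →
      slope j < slope i := by
    intro i j hi hi' t ht hx hy
    have h1 : 0 < qx - (R i).x₁ := by linarith
    have h2 : 0 < (1 - t) * (qx - (R i).x₁) := mul_pos (by linarith) h1
    have h3 : 0 < qx - (R j).x₁ := by linarith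
    have h4 : qy - (R j).y₂ < (1 - t) * (qy - (R i).y₂) := by linarith
    have h5 : (1 - t) * (qx - (R i).x₁) < qx - (R j).x₁ := by linarith
    rw [div_lt_div_iff₀ h3 h1]
    calc (qy - (R j).y₂) * (qx - (R i).x₁)
        < (1 - t) * (qy - (R i).y₂) * (qx - (R i).x₁) := mul_lt_mul_of_pos_right h4 h1
      _ = (qy - (R i).y₂) * ((1 - t) * (qx - (R i).x₁)) := by ring
      _ ≤ (qy - (R i).y₂) * (qx - (R j).x₁) :=
          mul_le_mul_of_nonneg_left h5.le (by linarith)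
  -- the line of sight ends at `q`, which is free
  have t_lt : ∀ (gx gy t : ℝ), t ≤ 1 → ∀ j, (R j).x₁ < gx + t * (qx - gx) →
      gx + t * (qx - gx) < (R j).x₂ → (R j).y₁ < gy + t * (qy - gy) →
      gy + t * (qy - gy) < (R j).y₂ → t < 1 := by
    intro gx gy t ht j h1 h2 h3 h4
    rcases ht.lt_or_eq with h | rfl
    · exact h
    · have := hq j (by simpa using h1) (by simpa using h3) (by simpa using h2)
      linarith
  by_cases hW : ∃ w, Rel w ∧ qy < (R w).y₂
  -- `w` has the easternmost east wall among those crossing the ray from `q` to the west. Its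
  -- north-west corner is above `q`, so its south-east corner competes instead with the north-west
  -- corners east of that wall.
  · obtain ⟨w, ⟨hw, hwy⟩, hmax⟩ := Set.exists_max_image {w | Rel w ∧ qy < (R w).y₂}
      (fun w => (R w).x₂) (Set.toFinite _) hW
    have hwx : (R w).x₂ ≤ qx := by
      by_contra h
      exact absurd (hq w hw.1 hw.2.1 (not_le.1 h)) (not_le.2 hwy)
    have hu := huv w hw.1 hw.2.1 hw.2.2.1 hw.2.2.2
    have hxw := (R w).hx
    have hyw := (R w).hy
    -- a relevant rectangle reaching beyond the wall of `w` does not cross the ray to the west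
    have beyond : ∀ j, Rel j → (R w).x₂ < (R j).x₂ →
        (R j).y₂ ≤ qy ∧ ((R w).x₂ < (R j).x₁ ∨ (R j).y₂ < (R w).y₁) := by
      intro j hj hjx
      have h1 : (R j).y₂ ≤ qy := by
        by_contra h
        exact absurd (hmax j ⟨hj, not_le.1 h⟩) (not_le.2 hjx)
      refine ⟨h1, ?_⟩
      have hne : w ≠ j := by rintro rfl; exact lt_irrefl _ hjx
      have hj1 := hj.2.1
      have := (R j).hy
      rcases hR w j hne with h | h | h | h
      · exact Or.inl h
      · linarith
      · linarith
      · exact Or.inr h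
    -- North-west corners above the line from the south-east corner of `w` to `q`; cross-multiplied
    -- because that line may be vertical.
    by_cases hA : ∃ i, (Rel i ∧ (R i).y₂ ≤ qy) ∧ (R w).x₂ ≤ (R i).x₁ ∧
        (qy - (R i).y₂) * (qx - (R w).x₂) < (qy - (R w).y₁) * (qx - (R i).x₁)
    · obtain ⟨i, ⟨⟨hi, hiy⟩, hiw, his⟩, hmin⟩ := Set.exists_min_image
        {i | (Rel i ∧ (R i).y₂ ≤ qy) ∧ (R w).x₂ ≤ (R i).x₁ ∧
          (qy - (R i).y₂) * (qx - (R w).x₂) < (qy - (R w).y₁) * (qx - (R i).x₁)}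
        slope (Set.toFinite _) hA
      refine ⟨i, hi.2.2, hi.1, hi.2.1, Or.inl ⟨hiy, clear_of_forall ?_⟩⟩
      simp only [Rect.corner]
      rintro t h0 h1 j px py rfl rfl hx1 hx2 hy1 hy2
      have ht := t_lt _ _ t h1 j hx1 hx2 hy1 hy2
      have a1 := le_lerp h0 h1 le_rfl hi.1.le
      have a2 := lerp_le h0 h1 hi.1.le le_rfl
      have b1 := le_lerp h0 h1 le_rfl hiy
      have b2 := lerp_le h0 h1 hiy le_rfl
      -- By `huv` the line of sight stays in the quadrant, so a blocker is again relevant.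
      have hvi := (huv i hi.1 hi.2.1 hi.2.2.1 hi.2.2.2).2
      have hyi := (R i).hy
      have hj : Rel j := ⟨by linarith, by linarith, by linarith, by linarith⟩
      -- A blocker east of `w` would have smaller slope; one below `w` cannot reach a line passing
      -- above the south-east corner of `w`.
      obtain ⟨hjy, hj' | hj'⟩ := beyond j hj (by linarith)
      · have hs := slope_lt i j hi.1 hiy t ht hx1 hy2
        refine absurd (hmin j ⟨⟨hj, hjy⟩, hj'.le, ?_⟩) (not_le.2 hs)
        have d1 : 0 < qx - (R i).x₁ := by linarith [hi.1]
        have d2 : 0 < qx - (R j).x₁ := by linarith [hj.1]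
        have d3 : 0 < qx - (R w).x₂ := by linarith
        rw [← div_lt_div_iff₀ d1 d3] at his
        rw [← div_lt_div_iff₀ d2 d3]
        exact lt_trans hs his
      · have d1 : 0 < qx - (R i).x₁ := by linarith [hi.1]
        have e1 : (R i).y₂ + t * (qy - (R i).y₂) < (R w).y₁ := by linarith
        have e2 : (1 - t) * (qx - (R i).x₁) ≤ qx - (R w).x₂ := by linarith
        have e3 : (qy - (R i).y₂) * ((1 - t) * (qx - (R i).x₁)) ≤
            (qy - (R i).y₂) * (qx - (R w).x₂) := mul_le_mul_of_nonneg_left e2 (by linarith)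
        have e4 : ((1 - t) * (qy - (R i).y₂)) * (qx - (R i).x₁) <
            (qy - (R w).y₁) * (qx - (R i).x₁) := by linarith
        have e5 := lt_of_mul_lt_mul_right e4 d1.le
        linarith
    · refine ⟨w, hw.2.2, hw.1, hw.2.1, Or.inr ⟨hwx, clear_of_forall ?_⟩⟩
      simp only [Rect.corner]
      rintro t h0 h1 j px py rfl rfl hx1 hx2 hy1 hy2
      have ht := t_lt _ _ t h1 j hx1 hx2 hy1 hy2
      have a1 := le_lerp h0 h1 le_rfl hwx
      have a2 := lerp_le h0 h1 hwx le_rfl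
      have b1 := le_lerp h0 h1 le_rfl hw.2.1.le
      have b2 := lerp_le h0 h1 hw.2.1.le le_rfl
      have hj : Rel j := ⟨by linarith, by linarith, by linarith, by linarith⟩
      obtain ⟨hjy, hj' | hj'⟩ := beyond j hj (by linarith)
      · refine hA ⟨j, ⟨hj, hjy⟩, hj'.le, ?_⟩
        have d1 : 0 < qx - (R w).x₂ := by linarith [hj.1]
        have d2 : 0 < qy - (R w).y₁ := by linarith [hw.2.1]
        calc (qy - (R j).y₂) * (qx - (R w).x₂)
            < ((1 - t) * (qy - (R w).y₁)) * (qx - (R w).x₂) :=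
              mul_lt_mul_of_pos_right (by linarith) d1
          _ = (qy - (R w).y₁) * ((1 - t) * (qx - (R w).x₂)) := by ring
          _ ≤ (qy - (R w).y₁) * (qx - (R j).x₁) :=
              mul_le_mul_of_nonneg_left (by linarith) d2.le
      · linarith
  · have hA : ∀ i, Rel i → (R i).y₂ ≤ qy := fun i hi => by
      by_contra h
      exact hW ⟨i, hi, not_le.1 h⟩
    obtain ⟨i, hi, hmin⟩ := Set.exists_min_image {i | Rel i} slope (Set.toFinite _) hex
    have hiy := hA i hi
    refine ⟨i, hi.2.2, hi.1, hi.2.1, Or.inl ⟨hiy, clear_of_forall ?_⟩⟩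
    simp only [Rect.corner]
    rintro t h0 h1 j px py rfl rfl hx1 hx2 hy1 hy2
    have ht := t_lt _ _ t h1 j hx1 hx2 hy1 hy2
    have a1 := le_lerp h0 h1 le_rfl hi.1.le
    have a2 := lerp_le h0 h1 hi.1.le le_rfl
    have b1 := le_lerp h0 h1 le_rfl hiy
    have b2 := lerp_le h0 h1 hiy le_rfl
    have hui := huv i hi.1 hi.2.1 hi.2.2.1 hi.2.2.2
    have hyi := (R i).hy
    have hj : Rel j := ⟨by linarith, by linarith, by linarith, by linarith⟩
    exact absurd (hmin j hj) (not_le.2 (slope_lt i j hi.1 hiy t ht hx1 hy2))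

/-! ### Rotation by a right angle -/

/-- The counterclockwise rotation by a right angle. -/
def rotPoint (p : ℝ × ℝ) : ℝ × ℝ := (-p.2, p.1)

/-- The rectangle rotated counterclockwise by a right angle. -/
def Rect.rot (R : Rect) : Rect where
  x₁ := -R.y₂
  x₂ := -R.y₁
  y₁ := R.x₁
  y₂ := R.x₂
  hx := neg_lt_neg R.hy
  hy := R.hx

/-- The corner that rotates to the given one. -/
def Corner.unrot : Corner → Corner
  | .southEast => .southWest
  | .northEast => .southEast
  | .northWest => .northEast
  | .southWest => .northWest

/-- The direction that rotates to the given one. -/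
def Direction.unrot : Direction → Direction
  | .north => .east
  | .west => .north
  | .south => .west
  | .east => .south

theorem Rect.corner_rot (R : Rect) (c : Corner) : R.rot.corner c = rotPoint (R.corner c.unrot) := by
  cases c <;> rfl

theorem rotPoint_mem_halfPlane_iff (g q : ℝ × ℝ) (d : Direction) :
    rotPoint q ∈ halfPlane (rotPoint g) d ↔ q ∈ halfPlane g d.unrot := by
  cases d <;> simp [halfPlane, rotPoint, Direction.unrot]

theorem Rect.rotPoint_mem_inner_iff (R : Rect) (q : ℝ × ℝ) :
    rotPoint q ∈ R.rot.inner ↔ q ∈ R.inner := by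
  simp only [Rect.inner, Rect.rot, rotPoint, Set.mem_prod, Set.mem_Ioo, neg_lt_neg_iff]
  tauto

theorem Rect.rotPoint_mem_closed_iff (R : Rect) (q : ℝ × ℝ) :
    rotPoint q ∈ R.rot.closed ↔ q ∈ R.closed := by
  simp only [Rect.closed, Rect.rot, rotPoint, Set.mem_prod, Set.mem_Icc, neg_le_neg_iff]
  tauto

/-- The family of rotated rectangles. -/
def rotFamily {ι : Type*} (R : ι → Rect) : ι → Rect := fun i => (R i).rot

theorem clear_rotFamily_iff {ι : Type*} (R : ι → Rect) (g q : ℝ × ℝ) :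
    Clear (rotFamily R) (rotPoint g) (rotPoint q) ↔ Clear R g q := by
  unfold Clear
  refine forall_congr' fun t => forall_congr' fun _ => forall_congr' fun _ =>
    forall_congr' fun j => not_congr ?_
  rw [← Rect.rotPoint_mem_inner_iff (R j), rotFamily]
  simp only [rotPoint]
  rw [show -g.2 + t * (-q.2 - -g.2) = -(g.2 + t * (q.2 - g.2)) by ring]

theorem Separated.rot {ι : Type*} {R : ι → Rect} (hR : Separated R) : Separated (rotFamily R) := by
  intro i j hij
  simp only [rotFamily, Rect.rot, neg_lt_neg_iff]
  have := hR i j hij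
  tauto

/-- The counterpart of `exists_visible_corner` for rectangles north-east of `q`. -/
theorem exists_visible_corner' {ι : Type*} [Finite ι] {R : ι → Rect} (hR : Separated R)
    {q : ℝ × ℝ} (hq : ∀ i, q ∉ (R i).inner) (u v : ℝ)
    (huv : ∀ i, q.1 < (R i).x₂ → q.2 < (R i).y₂ → (R i).x₁ < u → (R i).y₁ < v →
      (R i).x₂ ≤ u ∧ (R i).y₂ ≤ v)
    (hex : ∃ i, q.1 < (R i).x₂ ∧ q.2 < (R i).y₂ ∧ (R i).x₁ < u ∧ (R i).y₁ < v) :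
    ∃ i, ((R i).x₁ < u ∧ (R i).y₁ < v) ∧ q.1 < (R i).x₂ ∧ q.2 < (R i).y₂ ∧
      ((q.2 ≤ (R i).y₁ ∧ Clear R ((R i).corner .southEast) q) ∨
        (q.1 ≤ (R i).x₁ ∧ Clear R ((R i).corner .northWest) q)) := by
  -- A half turn exchanges the two quadrants and the two kinds of corner.
  have key := exists_visible_corner (R := rotFamily (rotFamily R)) hR.rot.rot
    (q := rotPoint (rotPoint q))
    (fun i => by
      simpa only [rotFamily, Rect.rotPoint_mem_inner_iff] using hq i) (-u) (-v)
  have hc : ∀ i c, (rotFamily (rotFamily R) i).corner c =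
      rotPoint (rotPoint ((R i).corner c.unrot.unrot)) := fun i c => by
    simp only [rotFamily, Rect.corner_rot]
  simp only [hc, clear_rotFamily_iff] at key
  simp only [rotFamily, Rect.rot, rotPoint, neg_lt_neg_iff, neg_le_neg_iff, Corner.unrot] at key
  exact key huv hex

/-! ### Guarding the free part of the plane -/

/-- A planar camera: a rectangle, one of its corners, and a viewing direction. -/
abbrev Guard (ι : Type*) : Type _ := ι × Corner × Direction

/-- The camera sees the point of the plane. -/
def Watches {ι : Type*} (R : ι → Rect) (a : Guard ι) (q : ℝ × ℝ) : Prop :=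
  q ∈ halfPlane ((R a.1).corner a.2.1) a.2.2 ∧ Clear R ((R a.1).corner a.2.1) q

/-- The cameras see the whole plane outside the open rectangles, and every rectangle has a camera
that faces it. -/
def Patrols {ι : Type*} (R : ι → Rect) (S : Finset (Guard ι)) : Prop :=
  (∀ q, (∀ i, q ∉ (R i).inner) → ∃ a ∈ S, Watches R a q) ∧
    ∀ i, ∃ c d, (i, c, d) ∈ S ∧ (R i).closed ⊆ halfPlane ((R i).corner c) d

/-- Some `n` cameras patrol the family. -/
def Guardable {ι : Type*} (R : ι → Rect) (n : ℕ) : Prop :=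
  ∃ S : Finset (Guard ι), S.card ≤ n ∧ Patrols R S

theorem Guardable.mono {ι : Type*} {R : ι → Rect} {m n : ℕ} (h : Guardable R m) (hmn : m ≤ n) :
    Guardable R n :=
  let ⟨S, hS, hS'⟩ := h
  ⟨S, hS.trans hmn, hS'⟩

theorem Guardable.of_rot {ι : Type*} {R : ι → Rect} {n : ℕ} (h : Guardable (rotFamily R) n) :
    Guardable R n := by
  classical
  obtain ⟨S, hS, hfree, hroof⟩ := h
  refine ⟨S.image fun a => (a.1, a.2.1.unrot, a.2.2.unrot), Finset.card_image_le.trans hS, ?_, ?_⟩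
  · intro q hq
    obtain ⟨a, ha, hw⟩ := hfree (rotPoint q) fun i => by
      simpa only [rotFamily, Rect.rotPoint_mem_inner_iff] using hq i
    refine ⟨_, Finset.mem_image_of_mem _ ha, ?_⟩
    simp only [Watches, Rect.corner_rot, rotFamily, rotPoint_mem_halfPlane_iff] at hw ⊢
    exact ⟨hw.1, (clear_rotFamily_iff _ _ _).1 hw.2⟩
  · intro i
    obtain ⟨c, d, hcd, hsub⟩ := hroof i
    refine ⟨c.unrot, d.unrot, Finset.mem_image.2 ⟨_, hcd, rfl⟩, fun q hq => ?_⟩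
    have := hsub ((Rect.rotPoint_mem_closed_iff (R i) q).2 hq)
    simpa only [rotFamily, Rect.corner_rot, rotPoint_mem_halfPlane_iff] using this

open Classical in
/-- Cameras at the north-west and south-east corner of each rectangle, facing East if the rectangle
satisfies `p` and West otherwise. -/
noncomputable def diagonalGuards {ι : Type*} [Fintype ι] (p : ι → Prop) : Finset (Guard ι) :=
  (Finset.univ : Finset (ι × Bool)).image fun a =>
    (a.1, if a.2 then Corner.northWest else Corner.southEast,
      if p a.1 then Direction.east else Direction.west)

theorem card_diagonalGuards_le {ι : Type*} [Fintype ι] (p : ι → Prop) :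
    (diagonalGuards p).card ≤ 2 * Fintype.card ι := by
  classical
  refine Finset.card_image_le.trans ?_
  simp [mul_comm]

theorem northWest_east_mem {ι : Type*} [Fintype ι] {p : ι → Prop} {i : ι} (hi : p i) :
    (i, Corner.northWest, Direction.east) ∈ diagonalGuards p :=
  by classical exact Finset.mem_image.2 ⟨(i, true), Finset.mem_univ _, by simp [hi]⟩

theorem southEast_east_mem {ι : Type*} [Fintype ι] {p : ι → Prop} {i : ι} (hi : p i) :
    (i, Corner.southEast, Direction.east) ∈ diagonalGuards p :=
  by classical exact Finset.mem_image.2 ⟨(i, false), Finset.mem_univ _, by simp [hi]⟩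

theorem northWest_west_mem {ι : Type*} [Fintype ι] {p : ι → Prop} {i : ι} (hi : ¬ p i) :
    (i, Corner.northWest, Direction.west) ∈ diagonalGuards p :=
  by classical exact Finset.mem_image.2 ⟨(i, true), Finset.mem_univ _, by simp [hi]⟩

theorem southEast_west_mem {ι : Type*} [Fintype ι] {p : ι → Prop} {i : ι} (hi : ¬ p i) :
    (i, Corner.southEast, Direction.west) ∈ diagonalGuards p :=
  by classical exact Finset.mem_image.2 ⟨(i, false), Finset.mem_univ _, by simp [hi]⟩

theorem diagonalGuards_face {ι : Type*} [Fintype ι] (R : ι → Rect) (p : ι → Prop) (i : ι) :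
    ∃ c d, (i, c, d) ∈ diagonalGuards p ∧ (R i).closed ⊆ halfPlane ((R i).corner c) d := by
  by_cases hi : p i
  · exact ⟨_, _, northWest_east_mem hi, fun q hq => hq.1.1⟩
  · exact ⟨_, _, southEast_west_mem hi, fun q hq => hq.1.2⟩

/-! ### Extremal rectangles and the number of extra cameras -/

/-- No other rectangle starts both weakly west and weakly south of the `i`-th one. -/
def SouthWestMinimal {ι : Type*} (R : ι → Rect) (i : ι) : Prop :=
  ∀ j, j ≠ i → (R j).x₁ ≤ (R i).x₁ → (R i).y₁ < (R j).y₁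

/-- No other rectangle ends weakly east and starts weakly south of the `i`-th one. -/
def SouthEastMinimal {ι : Type*} (R : ι → Rect) (i : ι) : Prop :=
  ∀ j, j ≠ i → (R i).x₂ ≤ (R j).x₂ → (R i).y₁ < (R j).y₁

/-- After the turn the two conditions are contrapositives of each other, so the weak and strict
inequalities match exactly. -/
theorem southEastMinimal_rotFamily_iff {ι : Type*} (R : ι → Rect) (i : ι) :
    SouthEastMinimal (rotFamily R) i ↔ SouthWestMinimal R i := by
  simp only [SouthEastMinimal, SouthWestMinimal, rotFamily, Rect.rot, neg_le_neg_iff]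
  refine forall_congr' fun j => forall_congr' fun _ => ?_
  simp only [← not_lt]
  exact not_imp_comm

theorem southWestMinimal_rot_rot_rot_iff {ι : Type*} (R : ι → Rect) (i : ι) :
    SouthWestMinimal (rotFamily (rotFamily (rotFamily R))) i ↔ SouthEastMinimal R i := by
  simp only [SouthEastMinimal, SouthWestMinimal, rotFamily, Rect.rot, neg_le_neg_iff, neg_lt_neg_iff]
  refine forall_congr' fun j => forall_congr' fun _ => ?_
  simp only [← not_lt]
  exact not_imp_comm

/-- A rectangle that is extreme towards both the south-east and the north-west splits the family
into two parts, for which two more cameras suffice. -/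
theorem guardable_of_extreme {ι : Type*} [Fintype ι] {R : ι → Rect} (hR : Separated R) (X : ι)
    (hse : SouthEastMinimal R X) (hnw : SouthWestMinimal (rotFamily R) X) :
    Guardable R (2 * Fintype.card ι + 2) := by
  classical
  have hXx := (R X).hx
  have hXy := (R X).hy
  -- The separating line decides one coordinate and extremality of `X` the other: every other
  -- rectangle is north-east or south-west of `X`.
  have split : ∀ j, j ≠ X →
      ((R X).x₁ < (R j).x₁ ∧ (R X).y₁ < (R j).y₁ ∧
        ((R X).x₂ < (R j).x₁ ∨ (R X).y₂ < (R j).y₁)) ∨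
      ((R j).x₂ < (R X).x₂ ∧ (R j).y₂ < (R X).y₂ ∧
        ((R j).x₂ < (R X).x₁ ∨ (R j).y₂ < (R X).y₁)) := by
    intro j hj
    have h1 := hse j hj
    have h2 : (R X).y₂ ≤ (R j).y₂ → (R X).x₁ < (R j).x₁ := by
      simpa only [rotFamily, Rect.rot, neg_le_neg_iff] using hnw j hj
    have hjx := (R j).hx
    have hjy := (R j).hy
    rcases hR j X hj with h | h | h | h
    · refine Or.inr ⟨by linarith, ?_, Or.inl h⟩
      by_contra hc
      linarith [h2 (not_lt.1 hc)]
    · exact Or.inl ⟨by linarith, h1 (by linarith), Or.inl h⟩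
    · refine Or.inr ⟨?_, by linarith, Or.inr h⟩
      by_contra hc
      linarith [h1 (not_lt.1 hc)]
    · exact Or.inl ⟨h2 (by linarith), by linarith, Or.inr h⟩
  -- The north-east part, including `X`, looks East and the rest West; the two extra cameras let `X`
  -- serve both parts.
  set p : ι → Prop := fun i => (R X).x₁ ≤ (R i).x₁ ∧ (R X).y₁ ≤ (R i).y₁ with hp
  have hpX : p X := ⟨le_rfl, le_rfl⟩
  refine ⟨diagonalGuards p ∪
    {(X, Corner.northWest, Direction.west), (X, Corner.southEast, Direction.west)},
    (Finset.card_union_le _ _).trans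
      (add_le_add (card_diagonalGuards_le p) Finset.card_le_two), ?_, ?_⟩
  · intro q hq
    have hnwX : q.1 ≤ (R X).x₁ →
        Clear R ((R X).corner .northWest) q → ∃ a ∈ diagonalGuards p ∪
          {(X, Corner.northWest, Direction.west), (X, Corner.southEast, Direction.west)},
          Watches R a q := by
      intro hd hc
      exact ⟨(X, .northWest, .west), by simp, hd, hc⟩
    have hseX : ∀ d, q ∈ halfPlane ((R X).corner .southEast) d → d = .east ∨ d = .west →
        Clear R ((R X).corner .southEast) q → ∃ a ∈ diagonalGuards p ∪
          {(X, Corner.northWest, Direction.west), (X, Corner.southEast, Direction.west)},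
          Watches R a q := by
      rintro d hd (rfl | rfl) hc
      · exact ⟨_, Finset.mem_union_left _ (southEast_east_mem hpX), hd, hc⟩
      · exact ⟨(X, .southEast, .west), by simp, hd, hc⟩
    by_cases hne : (R X).x₁ < q.1 ∧ (R X).y₁ < q.2
    · obtain ⟨i, hi, hi1, hi2, hc⟩ := exists_visible_corner hR hq (R X).x₁ (R X).y₁
        (fun i _ _ h3 h4 => by
          by_cases hiX : i = X
          · subst hiX; exact ⟨le_rfl, le_rfl⟩
          · rcases split i hiX with h | h
            · exact ⟨h.1.le, h.2.1.le⟩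
            · rcases h.2.2 with h | h <;> linarith)
        ⟨X, hne.1, hne.2, hXx, hXy⟩
      have hpi : p i := by
        by_cases hiX : i = X
        · subst hiX; exact hpX
        · rcases split i hiX with h | h
          · exact ⟨h.1.le, h.2.1.le⟩
          · rcases h.2.2 with h | h <;> linarith
      rcases hc with ⟨_, hc⟩ | ⟨h, hc⟩
      · exact ⟨_, Finset.mem_union_left _ (northWest_east_mem hpi), hi1.le, hc⟩
      · exact ⟨_, Finset.mem_union_left _ (southEast_east_mem hpi), h, hc⟩
    by_cases hsw : q.1 < (R X).x₂ ∧ q.2 < (R X).y₂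
    · obtain ⟨i, hi, hi1, hi2, hc⟩ := exists_visible_corner' hR hq (R X).x₂ (R X).y₂
        (fun i _ _ h3 h4 => by
          by_cases hiX : i = X
          · subst hiX; exact ⟨le_rfl, le_rfl⟩
          · rcases split i hiX with h | h
            · rcases h.2.2 with h | h <;> linarith
            · exact ⟨h.1.le, h.2.1.le⟩)
        ⟨X, hsw.1, hsw.2, hXx, hXy⟩
      by_cases hiX : i = X
      · subst hiX
        rcases hc with ⟨_, hc⟩ | ⟨h, hc⟩
        · exact hseX .west hi1.le (Or.inr rfl) hc
        · exact hnwX h hc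
      · have hpi : ¬ p i := by
          rintro ⟨h1, h2⟩
          have := (R i).hx
          have := (R i).hy
          rcases split i hiX with h | h <;> rcases h.2.2 with h | h <;> linarith
        rcases hc with ⟨_, hc⟩ | ⟨h, hc⟩
        · exact ⟨_, Finset.mem_union_left _ (southEast_west_mem hpi), hi1.le, hc⟩
        · exact ⟨_, Finset.mem_union_left _ (northWest_west_mem hpi), h, hc⟩
    -- What remains are the closed quadrants north-west and south-east of `X`, which no open
    -- rectangle meets.
    rw [not_and_or, not_lt, not_lt] at hne hsw
    by_cases hx : q.1 ≤ (R X).x₁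
    · have hy : (R X).y₂ ≤ q.2 := hsw.resolve_left (by linarith)
      refine hnwX hx (clear_of_forall ?_)
      simp only [Rect.corner]
      rintro t h0 h1 j px py rfl rfl hx1 hx2 hy1 hy2
      have a := lerp_le h0 h1 le_rfl hx
      have b := le_lerp h0 h1 le_rfl hy
      by_cases hjX : j = X
      · subst hjX; linarith
      · rcases split j hjX with h | h <;> linarith
    · have hy := hne.resolve_left hx
      have hx : (R X).x₂ ≤ q.1 := hsw.resolve_right (by linarith)
      refine hseX .east hx (Or.inl rfl) (clear_of_forall ?_)
      simp only [Rect.corner]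
      rintro t h0 h1 j px py rfl rfl hx1 hx2 hy1 hy2
      have a := le_lerp h0 h1 le_rfl hx
      have b := lerp_le h0 h1 le_rfl hy
      by_cases hjX : j = X
      · subst hjX; linarith
      · rcases split j hjX with h | h <;> linarith
  · intro i
    obtain ⟨c, d, h, h'⟩ := diagonalGuards_face R p i
    exact ⟨c, d, Finset.mem_union_left _ h, h'⟩

open Classical in
/-- If every rectangle that starts south of `X` lies in the southern shadow of `X`, the number of
additional cameras is bounded by the number of south-west minimal rectangles that start weakly north
of `X`. -/
theorem guardable_of_shadow {ι : Type*} [Fintype ι] {R : ι → Rect} (hR : Separated R) (X : ι)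
    (hX : ∀ i, (R i).y₁ < (R X).y₁ →
      (R X).x₁ < (R i).x₁ ∧ (R i).x₂ ≤ (R X).x₂ ∧ (R i).y₂ ≤ (R X).y₁) :
    Guardable R (2 * Fintype.card ι +
      ((Finset.univ.filter fun i => SouthWestMinimal R i ∧ (R X).y₁ ≤ (R i).y₁).card + 2)) := by
  set v := (R X).y₁ with hv
  obtain ⟨j, hj, hjmin⟩ := Set.exists_min_image {i | v ≤ (R i).y₁} (fun i => (R i).x₁)
    (Set.toFinite _) ⟨X, le_refl v⟩
  have hj : v ≤ (R j).y₁ := hj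
  have hjmin : ∀ i, v ≤ (R i).y₁ → (R j).x₁ ≤ (R i).x₁ := hjmin
  set p : ι → Prop := fun i => v ≤ (R i).y₁ with hp
  set St := Finset.univ.filter fun i => SouthWestMinimal R i ∧ v ≤ (R i).y₁ with hSt
  refine ⟨diagonalGuards p ∪ (St.image (fun i => (i, Corner.southWest, Direction.east)) ∪
      {(j, Corner.southWest, Direction.west), (X, Corner.southEast, Direction.south)}),
    (Finset.card_union_le _ _).trans (add_le_add (card_diagonalGuards_le p)
      ((Finset.card_union_le _ _).trans
        (add_le_add Finset.card_image_le Finset.card_le_two))), ?_, ?_⟩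
  · intro q hq
    -- The line at height `v` cuts no open rectangle, so the two sides can be treated separately.
    have upper : ∀ i, v < (R i).y₂ → v ≤ (R i).y₁ := by
      intro i hi
      by_contra hc
      linarith [(hX i (not_le.1 hc)).2.2]
    rcases lt_or_ge q.2 v with hqv | hqv
    · by_cases hex : ∃ i, q.1 < (R i).x₂ ∧ q.2 < (R i).y₂ ∧ (R i).x₁ < (R X).x₂ ∧ (R i).y₁ < v
      · obtain ⟨i, hi, hi1, hi2, hc⟩ := exists_visible_corner' hR hq (R X).x₂ v
          (fun i _ _ _ h4 => (hX i h4).2) hex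
        have hpi : ¬ p i := not_le.2 hi.2
        rcases hc with ⟨_, hc⟩ | ⟨h, hc⟩
        · exact ⟨_, Finset.mem_union_left _ (southEast_west_mem hpi), hi1.le, hc⟩
        · exact ⟨_, Finset.mem_union_left _ (northWest_west_mem hpi), h, hc⟩
      · refine ⟨(X, .southEast, .south), by simp, hqv.le, clear_of_forall ?_⟩
        simp only [Rect.corner]
        rintro t h0 h1 i px py rfl rfl hx1 hx2 hy1 hy2
        have a := lerp_le h0 h1 le_rfl hqv.le
        have b := le_lerp h0 h1 hqv.le le_rfl
        have hi := hX i (by linarith)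
        have := (R i).hx
        rcases le_total q.1 (R X).x₂ with h | h
        · have c := le_lerp h0 h1 h le_rfl
          exact hex ⟨i, by linarith, by linarith, by linarith, by linarith⟩
        · have c := le_lerp h0 h1 le_rfl h
          linarith
    -- The westernmost side as apex coordinate makes the western restriction void.
    · obtain ⟨l, -, hl⟩ := Set.exists_min_image Set.univ (fun i => (R i).x₁)
        (Set.toFinite _) ⟨X, trivial⟩
      have hl : ∀ i, (R l).x₁ ≤ (R i).x₁ := fun i => hl i trivial
      by_cases hex : ∃ i, (R i).x₁ < q.1 ∧ (R i).y₁ < q.2 ∧ (R l).x₁ < (R i).x₂ ∧ v < (R i).y₂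
      · obtain ⟨i, hi, hi1, hi2, hc⟩ := exists_visible_corner hR hq (R l).x₁ v
          (fun i _ _ _ h4 => ⟨hl i, upper i h4⟩) hex
        have hpi : p i := upper i hi.2
        rcases hc with ⟨_, hc⟩ | ⟨h, hc⟩
        · exact ⟨_, Finset.mem_union_left _ (northWest_east_mem hpi), hi1.le, hc⟩
        · exact ⟨_, Finset.mem_union_left _ (southEast_east_mem hpi), h, hc⟩
      have hempty : ∀ i, v ≤ (R i).y₁ → (R i).x₁ < q.1 → q.2 ≤ (R i).y₁ := by
        intro i hi hiq
        by_contra hc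
        have := (R i).hx
        have := (R i).hy
        exact hex ⟨i, hiq, not_le.1 hc, by linarith [hl i], by linarith⟩
      by_cases hT : ∃ i, v ≤ (R i).y₁ ∧ (R i).x₁ < q.1
      -- The lowest upper rectangle starting west of `q`, ties broken westward. Nothing starting
      -- below it can obstruct its view of `q`.
      · obtain ⟨i, ⟨hiv, hiq⟩, himin⟩ := Set.exists_min_image
          {i | v ≤ (R i).y₁ ∧ (R i).x₁ < q.1} (fun i => toLex ((R i).y₁, (R i).x₁))
          (Set.toFinite _) hT
        have himin : ∀ m, v ≤ (R m).y₁ → (R m).x₁ < q.1 →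
            (R i).y₁ < (R m).y₁ ∨ (R i).y₁ = (R m).y₁ ∧ (R i).x₁ ≤ (R m).x₁ := fun m h h' =>
          Prod.Lex.toLex_le_toLex.1 (himin m ⟨h, h'⟩)
        have hsw : SouthWestMinimal R i := by
          intro m hm hmx
          rcases le_or_gt v (R m).y₁ with hmv | hmv
          · rcases himin m hmv (by linarith) with h | ⟨h, h'⟩
            · exact h
            · have := (R i).hx
              have := (R i).hy
              have := (R m).hx
              have := (R m).hy
              rcases hR m i hm with h | h | h | h <;> linarith
          -- A rectangle in the shadow starts east of `X`, so `X` itself would have preceded `i`.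
          · have hmX := (hX m hmv).1
            rcases himin X le_rfl (by linarith) with h | ⟨h, h'⟩ <;> linarith
        have hiy := hempty i hiv hiq
        refine ⟨(i, .southWest, .east), Finset.mem_union_right _ (Finset.mem_union_left _
          (Finset.mem_image.2 ⟨i, by simp [hSt, hsw, hiv], rfl⟩)), hiq.le, clear_of_forall ?_⟩
        simp only [Rect.corner]
        rintro t h0 h1 m px py rfl rfl hx1 hx2 hy1 hy2
        have a := lerp_le h0 h1 hiq.le le_rfl
        have b := lerp_le h0 h1 le_rfl hiy
        have c := le_lerp h0 h1 hiy le_rfl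
        rcases himin m (upper m (by linarith)) (by linarith) with h | ⟨h, h'⟩ <;> linarith
      · have hjq : q.1 ≤ (R j).x₁ := not_lt.1 fun h => hT ⟨j, hj, h⟩
        refine ⟨(j, .southWest, .west), by simp, hjq, clear_of_forall ?_⟩
        simp only [Rect.corner]
        rintro t h0 h1 m px py rfl rfl hx1 hx2 hy1 hy2
        have a := lerp_le h0 h1 le_rfl hjq
        have b := le_lerp h0 h1 hj hqv
        linarith [hjmin m (upper m (by linarith))]
  · intro i
    obtain ⟨c, d, h, h'⟩ := diagonalGuards_face R p i
    exact ⟨c, d, Finset.mem_union_left _ h, h'⟩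

-- Take `X` as the northernmost member of SW ∩ SE, or the lowest rectangle if there is none.
-- Everything starting south of `X` is then in its shadow, and only `X` itself can lie in SW ∩ SE at
-- or above its level. This costs one camera beyond the two of `guardable_of_shadow`.
open Classical in
theorem guardable_of_southWestMinimal {ι : Type*} [Fintype ι] [Nonempty ι] {R : ι → Rect}
    (hR : Separated R) :
    Guardable R (2 * Fintype.card ι +
      (Finset.univ.filter fun i => SouthWestMinimal R i ∧ ¬ SouthEastMinimal R i).card + 3) := by
  obtain ⟨X, hX, hXB⟩ : ∃ X, (∀ i, (R i).y₁ < (R X).y₁ →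
      (R X).x₁ < (R i).x₁ ∧ (R i).x₂ ≤ (R X).x₂ ∧ (R i).y₂ ≤ (R X).y₁) ∧
      ∀ i, SouthWestMinimal R i → SouthEastMinimal R i → (R X).y₁ ≤ (R i).y₁ → i = X := by
    by_cases hB : ∃ i, SouthWestMinimal R i ∧ SouthEastMinimal R i
    · obtain ⟨X, ⟨hsw, hse⟩, hmax⟩ := Set.exists_max_image
        {i | SouthWestMinimal R i ∧ SouthEastMinimal R i} (fun i => (R i).y₁)
        (Set.toFinite _) hB
      refine ⟨X, fun i hi => ?_, fun i h1 h2 h3 => ?_⟩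
      · have hne : i ≠ X := by rintro rfl; exact lt_irrefl _ hi
        have h1 : (R X).x₁ < (R i).x₁ := by
          by_contra hc
          linarith [hsw i hne (not_lt.1 hc)]
        have h2 : (R i).x₂ < (R X).x₂ := by
          by_contra hc
          linarith [hse i hne (not_lt.1 hc)]
        refine ⟨h1, h2.le, ?_⟩
        have := (R i).hx
        have := (R X).hy
        rcases hR i X hne with h | h | h | h <;> linarith
      · by_contra hne
        have h4 : (R i).y₁ ≤ (R X).y₁ := hmax i ⟨h1, h2⟩
        rcases le_total (R i).x₁ (R X).x₁ with h | h
        · linarith [hsw i hne h]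
        · linarith [h1 X (Ne.symm hne) h]
    · obtain ⟨X, -, hmin⟩ := Set.exists_min_image Set.univ (fun i => (R i).y₁)
        (Set.toFinite _) ⟨Classical.arbitrary ι, trivial⟩
      exact ⟨X, fun i hi => absurd (hmin i trivial) (not_le.2 hi),
        fun i h1 h2 => absurd ⟨i, h1, h2⟩ hB⟩
  refine (guardable_of_shadow hR X hX).mono ?_
  have hsub : (Finset.univ.filter fun i => SouthWestMinimal R i ∧ (R X).y₁ ≤ (R i).y₁) ⊆
      insert X (Finset.univ.filter fun i => SouthWestMinimal R i ∧ ¬ SouthEastMinimal R i) := by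
    intro i hi
    simp only [Finset.mem_filter, Finset.mem_univ, true_and, Finset.mem_insert] at hi ⊢
    by_cases h : SouthEastMinimal R i
    · exact Or.inl (hXB i hi.1 h hi.2)
    · exact Or.inr ⟨hi.1, h⟩
  have := (Finset.card_le_card hsub).trans (Finset.card_insert_le _ _)
  omega

theorem guardable_of_separated {ι : Type*} [Fintype ι] [Nonempty ι] {R : ι → Rect}
    (hR : Separated R) : Guardable R (2 * Fintype.card ι + Fintype.card ι / 4 + 4) := by
  classical
  by_cases h0 : ∃ i, SouthEastMinimal R i ∧ SouthWestMinimal (rotFamily R) i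
  · obtain ⟨X, h1, h2⟩ := h0
    exact (guardable_of_extreme hR X h1 h2).mono (by omega)
  by_cases h1 : ∃ i, SouthEastMinimal (rotFamily R) i ∧
      SouthWestMinimal (rotFamily (rotFamily R)) i
  · obtain ⟨X, h1, h2⟩ := h1
    exact (guardable_of_extreme hR.rot X h1 h2).of_rot.mono (by omega)
  have g0 := guardable_of_southWestMinimal hR
  have g1 := (guardable_of_southWestMinimal hR.rot).of_rot
  have g2 := (guardable_of_southWestMinimal hR.rot.rot).of_rot.of_rot
  have g3 := (guardable_of_southWestMinimal hR.rot.rot.rot).of_rot.of_rot.of_rot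
  simp only [southEastMinimal_rotFamily_iff, southWestMinimal_rot_rot_rot_iff] at h1 g0 g1 g2 g3
  -- Cyclically adjacent differences are disjoint by definition, opposite ones because SE ∩ NW and
  -- SW ∩ NE are empty.
  have count : (Finset.univ.filter fun i => SouthWestMinimal R i ∧ ¬ SouthEastMinimal R i).card +
      (Finset.univ.filter fun i => SouthWestMinimal (rotFamily R) i ∧
        ¬ SouthWestMinimal R i).card +
      (Finset.univ.filter fun i => SouthWestMinimal (rotFamily (rotFamily R)) i ∧
        ¬ SouthWestMinimal (rotFamily R) i).card +
      (Finset.univ.filter fun i => SouthEastMinimal R i ∧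
        ¬ SouthWestMinimal (rotFamily (rotFamily R)) i).card ≤ Fintype.card ι := by
    simp only [Finset.card_filter, ← Finset.sum_add_distrib]
    refine (Finset.sum_le_card_nsmul _ _ 1 fun i _ => ?_).trans (by simp)
    have e0 : ¬ (SouthEastMinimal R i ∧ SouthWestMinimal (rotFamily R) i) := fun h => h0 ⟨i, h⟩
    have e1 : ¬ (SouthWestMinimal R i ∧ SouthWestMinimal (rotFamily (rotFamily R)) i) :=
      fun h => h1 ⟨i, h⟩
    by_cases a : SouthWestMinimal R i <;> by_cases b : SouthEastMinimal R i <;>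
      by_cases c : SouthWestMinimal (rotFamily R) i <;>
      by_cases d : SouthWestMinimal (rotFamily (rotFamily R)) i <;> simp_all
  -- Pigeonhole on the four differences; the bound has one camera to spare.
  by_contra hc
  have c0 := fun h => hc (g0.mono h)
  have c1 := fun h => hc (g1.mono h)
  have c2 := fun h => hc (g2.mono h)
  have c3 := fun h => hc (g3.mono h)
  simp only [imp_false, not_le] at c0 c1 c2 c3
  omega

/-! ### From the plane to the city -/

theorem Rect.inner_subset_closed (R : Rect) : R.inner ⊆ R.closed :=
  Set.prod_mono Set.Ioo_subset_Icc_self Set.Ioo_subset_Icc_self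

namespace City

variable {k : ℕ}

/-- The base rectangles of the buildings. -/
def bases (K : City k) : Fin k → Rect := fun i => (K.building i).base

theorem separated_bases (K : City k) : Separated K.bases := by
  intro i j hij
  by_contra h
  simp only [not_or, not_lt] at h
  obtain ⟨h1, h2, h3, h4⟩ := h
  have hi := (K.bases i).hx
  have hj := (K.bases j).hx
  have hi' := (K.bases i).hy
  have hj' := (K.bases j).hy
  refine (K.building_disjoint i j hij).notMem_of_mem_left
    (a := (max (K.bases i).x₁ (K.bases j).x₁, max (K.bases i).y₁ (K.bases j).y₁)) ?_ ?_
  · exact ⟨⟨le_max_left _ _, max_le hi.le h1⟩, ⟨le_max_left _ _, max_le hi'.le h3⟩⟩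
  · exact ⟨⟨le_max_right _ _, max_le h2 hj.le⟩, ⟨le_max_right _ _, max_le h4 hj'.le⟩⟩

theorem disjoint_segment_of_clear (K : City k) {g q : Point}
    (h : Clear K.bases (g.1, g.2.1) (q.1, q.2.1)) (i : Fin k) :
    Disjoint (segment ℝ g q) (K.building i).opaquePart := by
  rw [Set.disjoint_left, segment_eq_image']
  rintro _ ⟨t, ht, rfl⟩ hp
  exact h t ht.1 ht.2 i hp.1

/-- A point of the surface lies over a free point of the plane or on a roof. -/
theorem surface_cases (K : City k) {q : Point} (hq : q ∈ K.surface) :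
    ((q.1, q.2.1) ∈ K.bounds.closed ∧ ∀ i, (q.1, q.2.1) ∉ (K.bases i).inner) ∨
      ∃ i, q ∈ (K.building i).roof := by
  rcases hq with (hq | hq) | hq
  · exact Or.inl ⟨hq.1, hq.2.1⟩
  · obtain ⟨i, hi⟩ := Set.mem_iUnion.1 hq
    refine Or.inl ⟨K.building_subset i hi.1.1, fun j hj => ?_⟩
    by_cases hij : i = j
    · subst hij
      exact hi.1.2 hj
    · exact Set.disjoint_left.1 (K.building_disjoint i j hij) hi.1.1
        (Rect.inner_subset_closed _ hj)
  · exact Or.inr (Set.mem_iUnion.1 hq)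

/-- The camera of the city that corresponds to a planar camera. -/
def camera (a : Guard (Fin k)) : Camera k := ⟨.onBuilding a.1 a.2.1, a.2.2⟩

theorem mem_halfSpace_iff (g q : Point) (d : Direction) :
    q ∈ halfSpace g d ↔ (q.1, q.2.1) ∈ halfPlane (g.1, g.2.1) d := by
  cases d <;> rfl

theorem sees_of_watches (K : City k) {a : Guard (Fin k)} {q : Point}
    (h : Watches K.bases a (q.1, q.2.1)) : K.Sees (camera a) q :=
  ⟨(mem_halfSpace_iff _ _ _).2 h.1, K.disjoint_segment_of_clear h.2⟩

theorem _root_.CityGuarding.Rect.corner_mem_closed (R : Rect) (c : Corner) :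
    R.corner c ∈ R.closed := by
  have := R.hx.le
  have := R.hy.le
  cases c <;> simp_all [Rect.corner, Rect.closed]

theorem _root_.CityGuarding.Rect.convex_closed (R : Rect) : Convex ℝ R.closed :=
  (convex_Icc _ _).prod (convex_Icc _ _)

/-- A camera that faces its own building sees the roof. -/
theorem sees_roof (K : City k) {i : Fin k} {c : Corner} {d : Direction}
    (h : (K.bases i).closed ⊆ halfPlane ((K.bases i).corner c) d) {q : Point}
    (hq : q ∈ (K.building i).roof) : K.Sees (camera (i, c, d)) q := by
  refine ⟨(mem_halfSpace_iff _ _ _).2 (h hq.1), fun j => ?_⟩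
  rw [Set.disjoint_left, segment_eq_image']
  rintro _ ⟨t, ht, rfl⟩ hp
  -- Over its own base the segment stays at roof height, where the building is not opaque; by
  -- convexity it never leaves that base.
  by_cases hij : i = j
  · subst hij
    have h1 := hp.2.2
    have h2 := hq.2
    simp only [camera, position, Prod.snd_add, Prod.smul_snd, Prod.snd_sub, smul_eq_mul, h2,
      sub_self, mul_zero, add_zero, lt_irrefl] at h1
  · refine Set.disjoint_left.1 (K.building_disjoint i j hij) ?_
      (Rect.inner_subset_closed _ hp.1)
    have := (K.bases i).convex_closed.add_smul_sub_mem ((K.bases i).corner_mem_closed c) hq.1 ht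
    exact this

theorem isGuardedBy_of_covers (K : City k) {S : Finset (Camera k)} {T : Finset (Guard (Fin k))}
    (hT : ∀ a ∈ T, camera a ∈ S)
    (hfree : ∀ q : Point, (q.1, q.2.1) ∈ K.bounds.closed →
      (∀ i, (q.1, q.2.1) ∉ (K.bases i).inner) → ∃ a ∈ S, K.Sees a q)
    (hroof : ∀ i, ∃ c d, (i, c, d) ∈ T ∧
      (K.bases i).closed ⊆ halfPlane ((K.bases i).corner c) d) : K.IsGuardedBy S := by
  intro q hq
  rcases K.surface_cases hq with ⟨h, h'⟩ | ⟨i, hi⟩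
  · exact hfree q h h'
  · obtain ⟨c, d, hm, hsub⟩ := hroof i
    exact ⟨_, hT _ hm, K.sees_roof hsub hi⟩

theorem exists_guards_on_buildings (K : City k) (hk : 0 < k) :
    ∃ S : Finset (Camera k),
      (∀ a ∈ S, a.IsOnBuilding) ∧ S.card ≤ 2 * k + k / 4 + 4 ∧ K.IsGuardedBy S := by
  classical
  have : Nonempty (Fin k) := ⟨⟨0, hk⟩⟩
  obtain ⟨T, hcard, hfree, hroof⟩ := guardable_of_separated K.separated_bases
  rw [Fintype.card_fin] at hcard
  refine ⟨T.image camera, ?_, Finset.card_image_le.trans hcard,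
    K.isGuardedBy_of_covers (fun a ha => Finset.mem_image_of_mem _ ha) (fun q _ hq => ?_) hroof⟩
  · intro a ha
    obtain ⟨b, -, rfl⟩ := Finset.mem_image.1 ha
    exact ⟨_, _, rfl⟩
  · obtain ⟨a, ha, hw⟩ := hfree _ hq
    exact ⟨_, Finset.mem_image_of_mem _ ha, K.sees_of_watches hw⟩

/-- With the apex at the south-west corner of P, the quadrant condition holds for every building. If
none is south-west of `q`, nothing separates `q` from that corner. -/
theorem exists_guards_with_corner (K : City k) :
    ∃ S : Finset (Camera k),
      (∀ a ∈ S, ∀ b ∈ S, a.IsOnBounds → b.IsOnBounds → a = b) ∧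
        S.card ≤ 2 * k + 1 ∧ K.IsGuardedBy S := by
  classical
  have hcard := card_diagonalGuards_le fun _ : Fin k => True
  rw [Fintype.card_fin] at hcard
  have hbounds : ∀ i, K.bounds.x₁ ≤ (K.bases i).x₁ ∧ K.bounds.y₁ ≤ (K.bases i).y₁ := fun i =>
    have h := K.building_subset i ((K.bases i).corner_mem_closed .southWest)
    ⟨h.1.1, h.2.1⟩
  refine ⟨insert (⟨.onBounds .southWest, .east⟩ : Camera k)
      ((diagonalGuards fun _ : Fin k => True).image camera), ?_,
    (Finset.card_insert_le _ _).trans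
      (Nat.succ_le_succ (Finset.card_image_le.trans hcard)),
    K.isGuardedBy_of_covers
      (fun a ha => Finset.mem_insert_of_mem (Finset.mem_image_of_mem _ ha)) (fun q hP hq => ?_)
      (diagonalGuards_face K.bases _)⟩
  · have unique : ∀ a ∈ insert (⟨.onBounds .southWest, .east⟩ : Camera k)
        ((diagonalGuards fun _ : Fin k => True).image camera), a.IsOnBounds →
        a = ⟨.onBounds .southWest, .east⟩ := by
      rintro a ha ⟨c, hc⟩
      rcases Finset.mem_insert.1 ha with rfl | ha
      · rfl
      · obtain ⟨b, -, rfl⟩ := Finset.mem_image.1 ha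
        exact absurd hc (by simp [camera])
    intro a ha b hb h h'
    rw [unique a ha h, unique b hb h']
  · by_cases hex : ∃ i, (K.bases i).x₁ < q.1 ∧ (K.bases i).y₁ < q.2.1 ∧
        K.bounds.x₁ < (K.bases i).x₂ ∧ K.bounds.y₁ < (K.bases i).y₂
    · obtain ⟨i, -, hi1, -, hc⟩ := exists_visible_corner K.separated_bases hq K.bounds.x₁
        K.bounds.y₁ (fun i _ _ _ _ => hbounds i) hex
      rcases hc with ⟨-, hc⟩ | ⟨h, hc⟩
      · exact ⟨_, Finset.mem_insert_of_mem
          (Finset.mem_image_of_mem _ (northWest_east_mem trivial)), K.sees_of_watches ⟨hi1.le, hc⟩⟩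
      · exact ⟨_, Finset.mem_insert_of_mem
          (Finset.mem_image_of_mem _ (southEast_east_mem trivial)), K.sees_of_watches ⟨h, hc⟩⟩
    · refine ⟨_, Finset.mem_insert_self _ _, hP.1.1,
        K.disjoint_segment_of_clear (clear_of_forall ?_)⟩
      simp only [position, Rect.corner]
      rintro t h0 h1 j px py rfl rfl hx1 hx2 hy1 hy2
      have a1 := lerp_le h0 h1 hP.1.1 le_rfl
      have b1 := lerp_le h0 h1 hP.2.1 le_rfl
      have hj := hbounds j
      have := (K.bases j).hx
      have := (K.bases j).hy
      simp only at a1 b1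
      exact hex ⟨j, by linarith, by linarith, by linarith, by linarith⟩

end City

end CityGuarding

theorem mainTheorem2 {k : ℕ} (K : CityGuarding.City k) :
    (0 < k → ∃ S : Finset (CityGuarding.Camera k),
      (∀ a ∈ S, a.IsOnBuilding) ∧ S.card ≤ 2 * k + k / 4 + 4 ∧ K.IsGuardedBy S) ∧
    (∃ S : Finset (CityGuarding.Camera k),
      (∀ a ∈ S, ∀ b ∈ S, a.IsOnBounds → b.IsOnBounds → a = b) ∧
        S.card ≤ 2 * k + 1 ∧ K.IsGuardedBy S) :=
  ⟨K.exists_guards_on_buildings, K.exists_guards_with_corner⟩
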